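/- Let $d\ge 2$ and let $\mathcal L:\mathcal M_d\to\mathcal M_d$ be a Liouvillian on the complex $d\times d$ matrices, i.e. $\mathcal L(f)=i[H,f]+\sum_i\big(L_i^\dagger fL_i-\tfrac12(L_i^\dagger L_if+fL_i^\dagger L_i)\big)$ for some Hermitian $H$ and finitely many $L_i\in\mathcal M_d$. Let $\mathcal L^*$ be its dual for the Hilbert–Schmidt inner product. Assume that $\mathcal L$ is primitive, i.e. there is exactly one density matrix $\sigma$ with $\mathcal L^*(\sigma)=0$ and it has full rank, and unital, i.e. $\mathcal L^*(\mathbb 1)=0$. For Hermitian $g$ put $\mathrm{Var}_\sigma(g)=\mathrm{tr}(\sigma^{1/2}g\sigma^{1/2}g)-\mathrm{tr}(\sigma^{1/2}g\sigma^{1/2})^2$ and $\mathcal E_2(g)=-\mathrm{tr}(\sigma^{1/2}g\sigma^{1/2}\mathcal L(g))$, and for positive definite $f$, with $X=\sigma^{1/4}f\sigma^{1/4}$, put $$\mathrm{Ent}_2(f)=\mathrm{tr}(X^2\log X)-\tfrac12\mathrm{tr}(X^2\log\sigma)-\tfrac12\,\mathrm{tr}(X^2)\log\mathrm{tr}(X^2).$$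 Let the spectral gap be $\lambda=\min\{\mathcal E_2(g)/\mathrm{Var}_\sigma(g): g=g^\dagger,\ \mathrm{Var}_\sigma(g)\ne0\}$, and let the Log-Sobolev constant $\alpha_2$ be the largest real $\alpha$ with $\alpha\,\mathrm{Ent}_2(f)\le\mathcal E_2(f)$ for all positive definite $f\in\mathcal M_d$. Then this minimum and this largest constant exist, and $$\alpha_2\ \ge\ \frac{2(1-2/d)\,\lambda}{\log(d-1)},$$ where for $d=2$ the factor $2(1-2/d)/\log(d-1)$ is read as its limit $1$, i.e. $\alpha_2\ge\lambda$. -/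

import Mathlib

open scoped Matrix ComplexOrder

noncomputable section

namespace QLogSobolev

variable {d : ℕ}

/-- The algebra of `d × d` complex matrices. -/
abbrev Mat (d : ℕ) : Type := Matrix (Fin d) (Fin d) ℂ

/-- `L` is a Liouvillian (in the Heisenberg picture): it has a Lindblad form
`L(f) = i[H, f] + ∑ᵢ (Lᵢ† f Lᵢ - ½ {Lᵢ† Lᵢ, f})` with `H` Hermitian. -/
def IsLiouvillian (L : Mat d →ₗ[ℂ] Mat d) : Prop :=
  ∃ (H : Mat d) (k : ℕ) (V : Fin k → Mat d), H.IsHermitian ∧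
    ∀ f : Mat d, L f = Complex.I • (H * f - f * H) +
      ∑ i, ((V i)ᴴ * f * V i - (1 / 2 : ℂ) • ((V i)ᴴ * V i * f + f * ((V i)ᴴ * V i)))

/-- The dual `L*` with respect to the Hilbert-Schmidt inner product `tr(A† B)`, given by its
matrix entries (see `trace_hsDual`, which characterizes it). -/
def hsDual (L : Mat d →ₗ[ℂ] Mat d) (B : Mat d) : Mat d :=
  Matrix.of fun i j => ((L (Matrix.single i j 1))ᴴ * B).trace

theorem trace_hsDual (L : Mat d →ₗ[ℂ] Mat d) (A B : Mat d) :
    (Aᴴ * hsDual L B).trace = ((L A)ᴴ * B).trace := by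
  have hA : L A = ∑ i, ∑ j, A i j • L (Matrix.single i j 1) := by
    conv_lhs => rw [Matrix.matrix_eq_sum_single A]
    simp only [map_sum]
    refine Finset.sum_congr rfl fun i _ => Finset.sum_congr rfl fun j _ => ?_
    rw [← map_smul, Matrix.smul_single, smul_eq_mul, mul_one]
  rw [hA]
  simp only [Matrix.conjTranspose_sum, Matrix.conjTranspose_smul, Finset.sum_mul,
    Matrix.trace_sum, Matrix.smul_mul, Matrix.trace_smul, smul_eq_mul]
  rw [Finset.sum_comm]
  simp only [Matrix.trace, Matrix.diag_apply, Matrix.mul_apply, Matrix.conjTranspose_apply,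
    hsDual, Matrix.of_apply]

/-- The dynamics are unital: `L*(1) = 0`. -/
def IsUnital (L : Mat d →ₗ[ℂ] Mat d) : Prop := hsDual L 1 = 0

/-- `ρ` is a state (density matrix). -/
def IsState (ρ : Mat d) : Prop := ρ.PosSemidef ∧ ρ.trace = 1

/-- `ρ` is a stationary state of `L`. -/
def IsStationaryState (L : Mat d →ₗ[ℂ] Mat d) (ρ : Mat d) : Prop :=
  IsState ρ ∧ hsDual L ρ = 0

/-- `L` is primitive: it has a unique stationary state, and that state has full rank. -/
def IsPrimitive (L : Mat d →ₗ[ℂ] Mat d) : Prop :=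
  ∃ σ : Mat d, σ.PosDef ∧ IsStationaryState L σ ∧ ∀ ρ : Mat d, IsStationaryState L ρ → ρ = σ

/-- `Γ_σ^s(f) = σ^{s/2} f σ^{s/2}`, with the real power of the positive definite matrix `σ`
taken by functional calculus. -/
def gammaPow (σ : Mat d) (s : ℝ) (f : Mat d) : Mat d :=
  cfc (fun x : ℝ => x ^ (s / 2)) σ * f * cfc (fun x : ℝ => x ^ (s / 2)) σ

/-- The weighted inner product `⟨f, g⟩_σ = tr(Γ_σ(f) g)`. It is a real number for Hermitian
`f`, `g`, `σ`, the only case in which it is used below. -/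
def wInner (σ f g : Mat d) : ℝ := (gammaPow σ 1 f * g).trace.re

/-- The weighted norm `‖f‖_{2,σ} = tr(|Γ_σ^{1/2}(f)|²)^{1/2}`, where `|X|² = X† X`. -/
def norm2 (σ f : Mat d) : ℝ :=
  Real.sqrt ((gammaPow σ (1 / 2) f)ᴴ * gammaPow σ (1 / 2) f).trace.re

/-- The variance `Var_σ(g) = tr(Γ_σ(g) g) - tr(Γ_σ(g))²`, for Hermitian `g`. -/
def variance (σ g : Mat d) : ℝ :=
  (gammaPow σ 1 g * g).trace.re - (gammaPow σ 1 g).trace.re ^ 2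

/-- The `𝕃₂` Dirichlet form `ℰ₂(f) = -⟨f, L(f)⟩_σ`, for Hermitian `f`. -/
def dirichlet2 (L : Mat d →ₗ[ℂ] Mat d) (σ f : Mat d) : ℝ := -wInner σ f (L f)

/-- The `𝕃₂` relative entropy of a positive definite `f`. -/
def ent2 (σ f : Mat d) : ℝ :=
  (gammaPow σ (1 / 2) f ^ 2 * cfc Real.log (gammaPow σ (1 / 2) f)).trace.re
    - 1 / 2 * (gammaPow σ (1 / 2) f ^ 2 * cfc Real.log σ).trace.re
    - 1 / 2 * norm2 σ f ^ 2 * Real.log (norm2 σ f ^ 2)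

/-- The Rayleigh quotients `ℰ₂(g) / Var_σ(g)` over Hermitian `g` with `Var_σ(g) ≠ 0`. -/
def gapQuotients (L : Mat d →ₗ[ℂ] Mat d) (σ : Mat d) : Set ℝ :=
  {r | ∃ g : Mat d, g.IsHermitian ∧ variance σ g ≠ 0 ∧ r = dirichlet2 L σ g / variance σ g}

/-- The spectral gap `λ`, the minimum of the Rayleigh quotients. -/
def spectralGap (L : Mat d →ₗ[ℂ] Mat d) (σ : Mat d) : ℝ := sInf (gapQuotients L σ)

/-- The real constants `α` for which `α Ent₂(f) ≤ ℰ₂(f)` for all positive definite `f`. -/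
def lsi2Constants (L : Mat d →ₗ[ℂ] Mat d) (σ : Mat d) : Set ℝ :=
  {α | ∀ f : Mat d, f.PosDef → α * ent2 σ f ≤ dirichlet2 L σ f}

/-- The Log-Sobolev constant `α₂`, the largest constant in the Log-Sobolev inequality. -/
def logSobolev2 (L : Mat d →ₗ[ℂ] Mat d) (σ : Mat d) : ℝ := sSup (lsi2Constants L σ)

/-- The factor `2(1 - 2/d) / log(d - 1)`, read at `d = 2` (where it is `0/0`) as its limit `1`. -/
def lsFactor (d : ℕ) : ℝ :=
  if d = 2 then 1 else 2 * (1 - 2 / (d : ℝ)) / Real.log ((d : ℝ) - 1)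

end QLogSobolev

end

open scoped Matrix ComplexOrder

namespace QLogSobolev

/-! Unitality makes the maximally mixed state `1/d` stationary, so primitivity forces `σ = 1/d`.
Since `σ` is scalar, entropy and variance of `f` depend only on the eigenvalues of `X = d^(-1/2) f`,
and everything noncommutative stays inside the Dirichlet form. The bound is then a chain: the
classical inequality `lsFactor d * Ent₂ ≤ Var` for the uniform measure on `d` points
(`lsFactor_mul_ent2_le`), followed by the Poincaré inequality `λ Var ≤ ℰ₂`.

The classical inequality is the logarithmic Sobolev inequality of the complete graph
(`complete_graph_log_sobolev`). With sum and sum of squares of the eigenvalues fixed, only `∑ y² log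
y` varies, and it is largest when all entries but the largest agree (`sum_sq_mul_log_le`). This
leaves a one-variable inequality (`two_point_log_sobolev`), settled by the signs of derivatives.

The gap is attained by compactness, after centering and normalizing `g`. The admissible constants
form a closed set, nonempty by the bound and bounded above because some `f` has positive entropy. -/

/-! ### Inequalities in one real variable -/

/-- A function vanishing at `1`, `a` whose derivative has the sign of `E`. -/
theorem nonneg_of_two_zeros {D E D' E' : ℝ → ℝ} {a r₁ r₂ : ℝ}
    (hD : ∀ w, 0 < w → HasDerivAt D (D' w) w) (hE : ∀ w, 0 < w → HasDerivAt E (E' w) w)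
    (hDE : ∀ w, 0 < w → ∃ k, 0 ≤ k ∧ D' w = k * E w)
    (h1 : 1 ≤ r₁) (h12 : r₁ ≤ r₂) (h2 : r₂ ≤ a)
    (hE1 : ∀ w, 1 ≤ w → w ≤ r₁ → 0 ≤ E' w) (hE2 : ∀ w, r₁ < w → w < r₂ → E' w ≤ 0)
    (hE3 : ∀ w, r₂ ≤ w → 0 ≤ E' w)
    (D1 : D 1 = 0) (Da : D a = 0) (E1 : E 1 = 0) (Ea : E a = 0) {w : ℝ} (hw : 1 ≤ w) :
    0 ≤ D w := by
  have mono : ∀ {F F' : ℝ → ℝ} {x y : ℝ}, (∀ w, 0 < w → HasDerivAt F (F' w) w) → 1 ≤ x → x ≤ y →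
      (∀ z, x < z → z < y → 0 ≤ F' z) → F x ≤ F y := by
    intro F F' x y hF hx hxy h
    have hc : ContinuousOn F (Set.Icc x y) := fun z hz =>
      (hF z (by linarith [hz.1])).continuousAt.continuousWithinAt
    refine monotoneOn_of_deriv_nonneg (convex_Icc x y) hc ?_ ?_
      (Set.left_mem_Icc.2 hxy) (Set.right_mem_Icc.2 hxy) hxy
    · intro z hz
      rw [interior_Icc] at hz
      exact (hF z (by linarith [hz.1])).differentiableAt.differentiableWithinAt
    · intro z hz
      rw [interior_Icc] at hz
      rw [(hF z (by linarith [hz.1])).deriv]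
      exact h z hz.1 hz.2
  have anti : ∀ {F F' : ℝ → ℝ} {x y : ℝ}, (∀ w, 0 < w → HasDerivAt F (F' w) w) → 1 ≤ x → x ≤ y →
      (∀ z, x < z → z < y → F' z ≤ 0) → F y ≤ F x := by
    intro F F' x y hF hx hxy h
    have := mono (F := fun z => -F z) (F' := fun z => -F' z) (fun w hw => (hF w hw).neg) hx hxy
      (fun z h1 h2 => by linarith [h z h1 h2])
    linarith
  have pos : ∀ z, 1 ≤ z → 0 ≤ E z → 0 ≤ D' z := by
    intro z hz h
    obtain ⟨k, hk, e⟩ := hDE z (by linarith)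
    rw [e]; positivity
  have neg : ∀ z, 1 ≤ z → E z ≤ 0 → D' z ≤ 0 := by
    intro z hz h
    obtain ⟨k, hk, e⟩ := hDE z (by linarith)
    rw [e]; exact mul_nonpos_of_nonneg_of_nonpos hk h
  have low : ∀ z, 1 ≤ z → z ≤ r₁ → 0 ≤ E z ∧ 0 ≤ D z := by
    have hEz : ∀ z, 1 ≤ z → z ≤ r₁ → 0 ≤ E z := fun z hz hz' => by
      rw [← E1]; exact mono hE le_rfl hz fun u hu hu' => hE1 u hu.le (hu'.le.trans hz')
    refine fun z hz hz' => ⟨hEz z hz hz', ?_⟩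
    rw [← D1]
    exact mono hD le_rfl hz fun u hu hu' => pos u hu.le (hEz u hu.le (hu'.le.trans hz'))
  have high : ∀ z, r₂ ≤ z → 0 ≤ D z := by
    intro z hz
    rw [← Da]
    rcases le_total z a with h | h
    · refine anti hD (by linarith) h fun u hu hu' => neg u (by linarith) ?_
      rw [← Ea]
      exact mono hE (by linarith) hu'.le fun t ht _ => hE3 t (by linarith)
    · refine mono hD (by linarith) h fun u hu hu' => pos u (by linarith) ?_
      rw [← Ea]
      exact mono hE (by linarith) hu.le fun t ht _ => hE3 t (by linarith)
  rcases le_total w r₁ with h | h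
  · exact (low w hw h).2
  rcases le_total r₂ w with h' | h'
  · exact high w h'
  -- `E` decreases between `r₁` and `r₂`, so its sign at `w` persists back to `r₁` if nonnegative
  -- and on to `r₂` if nonpositive; `D w` is compared with `D` at that end.
  rcases le_total 0 (E w) with hs | hs
  · refine (low r₁ h1 le_rfl).2.trans (mono hD h1 h fun u hu hu' => pos u (by linarith) ?_)
    exact hs.trans (anti hE (by linarith) hu'.le fun t ht ht' => hE2 t (by linarith) (by linarith))
  · refine (high r₂ le_rfl).trans (anti hD hw h' fun u hu hu' => neg u (by linarith) ?_)
    exact (anti hE (by linarith) hu.le fun t ht ht' => hE2 t (by linarith) (by linarith)).trans hs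

/-- Both sides vanish at `1`, and the difference has derivative `log x - (1 - 1/x) ≥ 0`. It supplies
the condition `2 ≤ l * (1 + a)` when `l = log a / (a - 1)`. -/
theorem two_mul_sub_one_le_mul_log {a : ℝ} (ha : 1 ≤ a) :
    2 * (a - 1) ≤ (1 + a) * Real.log a := by
  have hd : ∀ x : ℝ, 0 < x → HasDerivAt (fun x => (1 + x) * Real.log x - 2 * (x - 1))
      (Real.log x + (1 + x) * x⁻¹ - 2) x := by
    intro x hx
    have := (((hasDerivAt_id x).const_add 1).mul (Real.hasDerivAt_log hx.ne')).sub
      (((hasDerivAt_id x).sub_const 1).const_mul 2)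
    refine this.congr_deriv ?_
    simp only [id]
    field_simp
  have := monotoneOn_of_deriv_nonneg (convex_Ici (1 : ℝ))
    (f := fun x => (1 + x) * Real.log x - 2 * (x - 1))
    (fun x hx => (hd x (by linarith [Set.mem_Ici.1 hx])).continuousAt.continuousWithinAt)
    (fun x hx => by
      rw [interior_Ici] at hx
      exact (hd x (by linarith [Set.mem_Ioi.1 hx])).differentiableAt.differentiableWithinAt)
    (fun x hx => by
      rw [interior_Ici] at hx
      have hx0 : 0 < x := by linarith [Set.mem_Ioi.1 hx]
      rw [(hd x hx0).deriv]
      have h1 := Real.one_sub_inv_le_log_of_pos hx0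
      have h2 : (1 + x) * x⁻¹ = x⁻¹ + 1 := by field_simp
      linarith)
    (Set.mem_Ici.2 le_rfl) (Set.mem_Ici.2 ha) ha
  simp at this
  linarith

/-- The logarithmic Sobolev inequality of the two-point space with weights `1 : a`. -/
theorem two_point_log_sobolev {a l : ℝ} (ha : 1 ≤ a) (hl : l * (a - 1) = Real.log a)
    (hl2 : 2 ≤ l * (1 + a)) {w : ℝ} (hw : 1 ≤ w) :
    2 * (w ^ 2 * Real.log w) - (a + w ^ 2) * Real.log ((a + w ^ 2) / (1 + a)) ≤
      a * l * (w - 1) ^ 2 := by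
  have ha0 : 0 < a := by linarith
  have hl0 : 0 < l := by
    by_contra h
    nlinarith
  set D : ℝ → ℝ := fun w => a * l * (w - 1) ^ 2 - 2 * (w ^ 2 * Real.log w) +
    (a + w ^ 2) * Real.log ((a + w ^ 2) / (1 + a)) with hDdef
  set E : ℝ → ℝ := fun w => a * l * (1 - w⁻¹) - 2 * Real.log w +
    Real.log ((a + w ^ 2) / (1 + a)) with hEdef
  set D' : ℝ → ℝ := fun w => (2 * w) * E w with hD'def
  set E' : ℝ → ℝ := fun w => a * (l * (a + w ^ 2) - 2 * w) / (w ^ 2 * (a + w ^ 2)) with hE'def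
  have hlog : ∀ w : ℝ, 0 < w →
      HasDerivAt (fun w => Real.log ((a + w ^ 2) / (1 + a))) (2 * w / (a + w ^ 2)) w := by
    intro w hw
    have hne : (a + w ^ 2) / (1 + a) ≠ 0 := by positivity
    have := ((((hasDerivAt_id w).pow 2).const_add a).div_const (1 + a)).log hne
    refine this.congr_deriv ?_
    simp only [id, Pi.pow_apply, Nat.cast_ofNat]
    field_simp
    simp
  have hD : ∀ w, 0 < w → HasDerivAt D (D' w) w := by
    intro w hw
    have h1 := (((hasDerivAt_id w).sub_const 1).pow 2).const_mul (a * l)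
    have h2 := (((hasDerivAt_id w).pow 2).mul (Real.hasDerivAt_log hw.ne')).const_mul 2
    have h3 := (((hasDerivAt_id w).pow 2).const_add a).mul (hlog w hw)
    refine ((h1.sub h2).add h3).congr_deriv ?_
    simp only [hD'def, hEdef, id, Pi.pow_apply, Nat.cast_ofNat]
    field_simp
    ring
  have hE : ∀ w, 0 < w → HasDerivAt E (E' w) w := by
    intro w hw
    have h1 := ((hasDerivAt_inv hw.ne').const_sub 1).const_mul (a * l)
    have h2 := (Real.hasDerivAt_log hw.ne').const_mul 2
    refine ((h1.sub h2).add (hlog w hw)).congr_deriv ?_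
    simp only [hE'def]
    field_simp
    ring
  have hDE : ∀ w, 0 < w → ∃ k, 0 ≤ k ∧ D' w = k * E w := fun w hw =>
    ⟨2 * w, by positivity, rfl⟩
  have e1 : (a + (1 : ℝ) ^ 2) / (1 + a) = 1 := by field_simp; ring
  have ea : (a + a ^ 2) / (1 + a) = a := by field_simp
  have D1 : D 1 = 0 := by simp only [hDdef, e1]; simp
  have E1 : E 1 = 0 := by simp only [hEdef, e1]; simp
  -- The choice of `l` makes `w = a` a second case of equality besides `w = 1`, and a second zero of
  -- `E`.
  have Da : D a = 0 := by
    simp only [hDdef, ea, ← hl]; ring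
  have Ea : E a = 0 := by
    simp only [hEdef, ea, ← hl]; field_simp; ring
  have sgn : ∀ w, 0 < w → 0 ≤ l * (a + w ^ 2) - 2 * w → 0 ≤ E' w := fun w hw h => by
    simp only [hE'def]; positivity
  have sgn' : ∀ w, 0 < w → l * (a + w ^ 2) - 2 * w ≤ 0 → E' w ≤ 0 := fun w hw h => by
    simp only [hE'def]
    exact div_nonpos_of_nonpos_of_nonneg (mul_nonpos_of_nonneg_of_nonpos ha0.le h) (by positivity)
  suffices h : 0 ≤ D w by simp only [hDdef] at h; linarith
  -- The sign of `E'` is that of the quadratic `l * (a + w ^ 2) - 2 * w`, whose discriminant is `4 *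
  -- (1 - l ^ 2 * a)`.
  rcases lt_or_ge (1 - l ^ 2 * a) 0 with hdisc | hdisc
  · have hE0 : ∀ w, 0 < w → 0 ≤ E' w := fun w hw => sgn w hw <| by
      have : 0 ≤ l * (l * (a + w ^ 2) - 2 * w) := by nlinarith [sq_nonneg (l * w - 1)]
      exact nonneg_of_mul_nonneg_right this hl0
    -- Here `E` is increasing throughout, so the single zero `1` serves for both.
    exact nonneg_of_two_zeros (r₁ := 1) (r₂ := 1) (a := 1) hD hE hDE le_rfl le_rfl le_rfl
      (fun w h _ => hE0 w (by linarith))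
      (fun w h h' => absurd (h.trans h') (lt_irrefl _))
      (fun w h => hE0 w (by linarith)) D1 D1 E1 E1 hw
  · set s := Real.sqrt (1 - l ^ 2 * a) with hs
    have hss : s ^ 2 = 1 - l ^ 2 * a := Real.sq_sqrt hdisc
    have hs0 : 0 ≤ s := Real.sqrt_nonneg _
    have fac : ∀ w, l * (l * (a + w ^ 2) - 2 * w) = (l * w - (1 - s)) * (l * w - (1 + s)) := by
      intro w
      linear_combination hss
    -- The roots `(1 ∓ s) / l` have product `a ≥ 1`, and `hl2` says that the quadratic is
    -- nonnegative at `1`; hence the smaller root is at least `1`, and the larger at most `a`.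
    have hr1 : l ≤ 1 - s := by
      by_contra! h
      have h1 := fac 1
      have h2 : 0 ≤ l * (l * (a + 1 ^ 2) - 2 * 1) := mul_nonneg hl0.le (by linarith)
      rw [h1] at h2
      have h3 : 0 ≤ l - (1 + s) := by
        have := nonneg_of_mul_nonneg_right h2 (by linarith)
        linarith
      nlinarith
    have hr2 : 1 + s ≤ l * a := by
      have : (1 + s) * (1 - s) = l * (l * a) := by linear_combination -hss
      nlinarith
    have low : ∀ w, l * w ≤ 1 - s → 0 ≤ l * (a + w ^ 2) - 2 * w := fun w h => by
      refine nonneg_of_mul_nonneg_right ?_ hl0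
      rw [fac]; exact mul_nonneg_of_nonpos_of_nonpos (by linarith) (by linarith)
    have high : ∀ w, 1 + s ≤ l * w → 0 ≤ l * (a + w ^ 2) - 2 * w := fun w h => by
      refine nonneg_of_mul_nonneg_right ?_ hl0
      rw [fac]; exact mul_nonneg (by linarith) (by linarith)
    have mid : ∀ w, 1 - s ≤ l * w → l * w ≤ 1 + s → l * (a + w ^ 2) - 2 * w ≤ 0 := fun w h h' => by
      refine nonpos_of_mul_nonpos_right ?_ hl0
      rw [fac]; exact mul_nonpos_of_nonneg_of_nonpos (by linarith) (by linarith)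
    have h1 : 1 ≤ (1 - s) / l := by rw [le_div_iff₀ hl0]; linarith
    have h12 : (1 - s) / l ≤ (1 + s) / l := by gcongr; linarith
    refine nonneg_of_two_zeros (r₁ := (1 - s) / l) (r₂ := (1 + s) / l) (a := a) hD hE hDE h1 h12
      (by rw [div_le_iff₀ hl0]; linarith) (fun w hw hw' => sgn w (by linarith) (low w ?_))
      (fun w hw hw' => sgn' w (by linarith) (mid w ?_ ?_))
      (fun w hw => sgn w (by linarith) (high w ?_)) D1 Da E1 Ea hw
    · rw [le_div_iff₀ hl0] at hw'; linarith
    · rw [div_lt_iff₀ hl0] at hw; linarith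
    · rw [lt_div_iff₀ hl0] at hw'; linarith
    · rw [div_le_iff₀ hl0] at hw; linarith

/-- The quadratic `(t - 1) + K (t - 1)²` touches `t² log t` to first order at `1` and meets it at
`w`. After division by `t²` the difference has derivative `(t - 1)(t + 2 - 2K) / t³`, so it rises to
`0` at `1`, falls, and then can only rise again to `0` at `w`. Summing a quadratic majorant uses
only the first two moments. -/
theorem sq_mul_log_interpolation {t w : ℝ} (ht : 0 < t) (hw : 1 < w) (htw : t ≤ w) :
    (t ^ 2 * Real.log t) * (w - 1) ^ 2 ≤
      (t - 1) * (w - 1) ^ 2 + (t - 1) ^ 2 * (w ^ 2 * Real.log w - (w - 1)) := by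
  have hw1 : 0 < w - 1 := by linarith
  have hd : ∀ K x : ℝ, 0 < x →
      HasDerivAt (fun x => Real.log x - (x - 1) / x ^ 2 - K * ((x - 1) ^ 2 / x ^ 2))
        ((x - 1) * (x + 2 - 2 * K) / x ^ 3) x := by
    intro K x hx
    have h1 := (Real.hasDerivAt_log hx.ne').sub
      (((hasDerivAt_id x).sub_const 1).div ((hasDerivAt_id x).pow 2) (by simpa using hx.ne'))
    have h2 := ((((hasDerivAt_id x).sub_const 1).pow 2).div ((hasDerivAt_id x).pow 2)
      (by simpa using hx.ne')).const_mul K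
    refine (h1.sub h2).congr_deriv ?_
    simp only [id, Pi.pow_apply, Nat.cast_ofNat]
    field_simp
    norm_num
    ring
  have mono : ∀ K x y : ℝ, 0 < x → x ≤ y → (∀ z, x < z → z < y → 0 ≤ (z - 1) * (z + 2 - 2 * K)) →
      Real.log x - (x - 1) / x ^ 2 - K * ((x - 1) ^ 2 / x ^ 2) ≤
      Real.log y - (y - 1) / y ^ 2 - K * ((y - 1) ^ 2 / y ^ 2) := by
    intro K x y hx hxy h
    refine monotoneOn_of_deriv_nonneg (convex_Icc x y)
      (f := fun x => Real.log x - (x - 1) / x ^ 2 - K * ((x - 1) ^ 2 / x ^ 2))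
      (fun z hz => (hd K z (by linarith [hz.1])).continuousAt.continuousWithinAt) ?_ ?_
      (Set.left_mem_Icc.2 hxy) (Set.right_mem_Icc.2 hxy) hxy
    · intro z hz
      rw [interior_Icc] at hz
      exact (hd K z (by linarith [hz.1])).differentiableAt.differentiableWithinAt
    · intro z hz
      rw [interior_Icc] at hz
      rw [(hd K z (by linarith [hz.1])).deriv]
      have := hx.trans hz.1
      have := h z hz.1 hz.2
      positivity
  have anti : ∀ K x y : ℝ, 0 < x → x ≤ y → (∀ z, x < z → z < y → (z - 1) * (z + 2 - 2 * K) ≤ 0) →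
      Real.log y - (y - 1) / y ^ 2 - K * ((y - 1) ^ 2 / y ^ 2) ≤
      Real.log x - (x - 1) / x ^ 2 - K * ((x - 1) ^ 2 / x ^ 2) := by
    intro K x y hx hxy h
    refine antitoneOn_of_deriv_nonpos (convex_Icc x y)
      (f := fun x => Real.log x - (x - 1) / x ^ 2 - K * ((x - 1) ^ 2 / x ^ 2))
      (fun z hz => (hd K z (by linarith [hz.1])).continuousAt.continuousWithinAt) ?_ ?_
      (Set.left_mem_Icc.2 hxy) (Set.right_mem_Icc.2 hxy) hxy
    · intro z hz
      rw [interior_Icc] at hz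
      exact (hd K z (by linarith [hz.1])).differentiableAt.differentiableWithinAt
    · intro z hz
      rw [interior_Icc] at hz
      rw [(hd K z (by linarith [hz.1])).deriv]
      have := hx.trans hz.1
      exact div_nonpos_of_nonpos_of_nonneg (h z hz.1 hz.2) (by positivity)
  set K := (w ^ 2 * Real.log w - (w - 1)) / (w - 1) ^ 2 with hK
  have hKmul : K * (w - 1) ^ 2 = w ^ 2 * Real.log w - (w - 1) := by
    rw [hK]; field_simp
  have hKw : Real.log w - (w - 1) / w ^ 2 - K * ((w - 1) ^ 2 / w ^ 2) = 0 := by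
    rw [← mul_div_assoc, hKmul]; field_simp; ring
  -- For `K = 3/2` the derivative is `(z - 1)² / z³ ≥ 0`, so that function is nonnegative at `w`;
  -- this places the second critical point `2K - 2` at or beyond `1`.
  have hK2 : 3 / 2 ≤ K := by
    have h := mono (3 / 2) 1 w one_pos hw.le (fun z hz _ => by nlinarith)
    simp only [Real.log_one, sub_self, zero_div, one_pow] at h
    have h3 : 0 < (w - 1) ^ 2 / w ^ 2 := by positivity
    norm_num at h
    by_contra! hlt
    nlinarith
  have key : Real.log t - (t - 1) / t ^ 2 - K * ((t - 1) ^ 2 / t ^ 2) ≤ 0 := by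
    have h10 : Real.log 1 - ((1 : ℝ) - 1) / 1 ^ 2 - K * (((1 : ℝ) - 1) ^ 2 / 1 ^ 2) = 0 := by simp
    rcases le_total t 1 with h1 | h1
    · rw [← h10]
      exact mono K t 1 ht h1 fun z hz hz' => by nlinarith
    rcases le_total t (2 * K - 2) with h2 | h2
    · rw [← h10]
      exact anti K 1 t one_pos h1 fun z hz hz' => by nlinarith
    · rw [← hKw]
      exact mono K t w ht htw fun z hz hz' => mul_nonneg (by linarith) (by linarith)
  have key2 : t ^ 2 * Real.log t ≤ (t - 1) + K * (t - 1) ^ 2 := by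
    have h := mul_le_mul_of_nonneg_left key (sq_nonneg t)
    have e : t ^ 2 * (Real.log t - (t - 1) / t ^ 2 - K * ((t - 1) ^ 2 / t ^ 2)) =
        t ^ 2 * Real.log t - (t - 1) - K * (t - 1) ^ 2 := by field_simp
    rw [e] at h; linarith
  calc _ ≤ ((t - 1) + K * (t - 1) ^ 2) * (w - 1) ^ 2 := by gcongr
    _ = _ := by rw [← hKmul]; ring

/-! ### The logarithmic Sobolev inequality for positive vectors -/

section Vectors

variable {ι : Type*} [Fintype ι]

/-- Among positive vectors with given sum and sum of squares, `∑ t² log t` is largest when all but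
the largest entry agree. -/
theorem sum_sq_mul_log_le {a w : ℝ} {t : ι → ℝ} (ht : ∀ i, 0 < t i) (hw : 1 ≤ w)
    (ha : 0 ≤ a) (hcard : (Fintype.card ι : ℝ) = 1 + a) (h1 : ∑ i, t i = a + w)
    (h2 : ∑ i, t i ^ 2 = a + w ^ 2) :
    ∑ i, t i ^ 2 * Real.log (t i) ≤ w ^ 2 * Real.log w := by
  classical
  have hsub : ∑ i, (t i - 1) = w - 1 := by
    rw [Finset.sum_sub_distrib, h1]
    simp [hcard]
    ring
  have hsq : ∑ i, (t i - 1) ^ 2 = (w - 1) ^ 2 := by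
    have : ∀ i, (t i - 1) ^ 2 = t i ^ 2 - 2 * t i + 1 := fun i => by ring
    simp only [this, Finset.sum_add_distrib, Finset.sum_sub_distrib, ← Finset.mul_sum, h1, h2]
    simp [hcard]
    ring
  rcases hw.eq_or_lt with rfl | hw
  · have h0 : ∀ i, t i = 1 := by
      rw [sub_self, zero_pow two_ne_zero, Finset.sum_eq_zero_iff_of_nonneg
        (fun i _ => sq_nonneg _)] at hsq
      intro i
      have := hsq i (Finset.mem_univ i)
      have := pow_eq_zero_iff two_ne_zero |>.1 this
      linarith
    simp [h0]
  have hle : ∀ i, t i ≤ w := by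
    intro i
    by_contra! hlt
    -- Cauchy–Schwarz on the other `a` entries: an entry above `w` would leave them too small a sum
    -- of squares for their sum.
    have hcs := sq_sum_le_card_mul_sum_sq (s := Finset.univ.erase i) (f := t)
    have hc : ((Finset.univ.erase i).card : ℝ) = a := by
      have := Finset.card_erase_add_one (Finset.mem_univ i)
      have h' : ((Finset.univ.erase i).card : ℝ) + 1 = Fintype.card ι := by exact_mod_cast this
      linarith
    rw [hc] at hcs
    have e1 : ∑ j ∈ Finset.univ.erase i, t j = a + w - t i := by
      have := Finset.sum_erase_add Finset.univ t (Finset.mem_univ i); linarith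
    have e2 : ∑ j ∈ Finset.univ.erase i, t j ^ 2 = a + w ^ 2 - t i ^ 2 := by
      have := Finset.sum_erase_add Finset.univ (fun j => t j ^ 2) (Finset.mem_univ i)
      linarith
    rw [e1, e2] at hcs
    have hpos : 0 < (t i - w) ^ 2 := by nlinarith
    nlinarith [mul_nonneg (mul_nonneg ha (sub_nonneg.2 hlt.le)) (sub_nonneg.2 hw.le),
      mul_nonneg ha hpos.le]
  have hpos : 0 < (w - 1) ^ 2 := by nlinarith
  refine le_of_mul_le_mul_right ?_ hpos
  calc _ = ∑ i, t i ^ 2 * Real.log (t i) * (w - 1) ^ 2 := by rw [Finset.sum_mul]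
    _ ≤ ∑ i, ((t i - 1) * (w - 1) ^ 2 + (t i - 1) ^ 2 * (w ^ 2 * Real.log w - (w - 1))) :=
      Finset.sum_le_sum fun i _ => sq_mul_log_interpolation (ht i) hw (hle i)
    _ = _ := by
      rw [Finset.sum_add_distrib, ← Finset.sum_mul, ← Finset.sum_mul, hsub, hsq]; ring

/-- The logarithmic Sobolev inequality of the complete graph. -/
theorem complete_graph_log_sobolev {a l : ℝ} (ha : 1 ≤ a) (hl : l * (a - 1) = Real.log a)
    (hl2 : 2 ≤ l * (1 + a)) (hcard : (Fintype.card ι : ℝ) = 1 + a) {y : ι → ℝ}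
    (hy : ∀ i, 0 < y i) :
    2 * ∑ i, y i ^ 2 * Real.log (y i) + Real.log (1 + a) * ∑ i, y i ^ 2 -
      (∑ i, y i ^ 2) * Real.log (∑ i, y i ^ 2) ≤
      l * ((1 + a) * ∑ i, y i ^ 2 - (∑ i, y i) ^ 2) := by
  classical
  set S1 := ∑ i, y i with hS1
  set S2 := ∑ i, y i ^ 2 with hS2
  have ha0 : 0 < a := by linarith
  have hV : 0 ≤ (1 + a) * S2 - S1 ^ 2 := by
    have := sq_sum_le_card_mul_sum_sq (s := Finset.univ) (f := y)
    rw [Finset.card_univ, hcard] at this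
    linarith
  have hc2 : 1 < Fintype.card ι := by
    have : (1 : ℝ) < Fintype.card ι := by linarith
    exact_mod_cast this
  have : Nontrivial ι := Fintype.one_lt_card_iff_nontrivial.1 hc2
  have hS1pos : 0 < S1 := Finset.sum_pos (fun i _ => hy i) Finset.univ_nonempty
  -- Strict because there are at least two positive entries; this is what makes `v` positive.
  have hlt : S2 < S1 ^ 2 := by
    have hyl : ∀ i, y i < S1 := by
      intro i
      obtain ⟨j, hj⟩ := exists_ne i
      have := Finset.sum_erase_add Finset.univ y (Finset.mem_univ i)
      have h2 : 0 < ∑ k ∈ Finset.univ.erase i, y k :=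
        Finset.sum_pos (fun i _ => hy i) ⟨j, by simp [hj]⟩
      linarith
    have : ∑ i, y i ^ 2 < ∑ i, y i * S1 :=
      Finset.sum_lt_sum_of_nonempty Finset.univ_nonempty fun i _ => by nlinarith [hy i, hyl i]
    rw [← Finset.sum_mul] at this
    nlinarith
  -- The comparison vector has one entry `v * w` and `a` entries `v`, with the sum and sum of
  -- squares of `y`; `δ` is the difference `v * w - v`.
  set δ := Real.sqrt (((1 + a) * S2 - S1 ^ 2) / a) with hδ
  have hδ0 : 0 ≤ δ := Real.sqrt_nonneg _
  have hδ2 : a * δ ^ 2 = (1 + a) * S2 - S1 ^ 2 := by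
    rw [hδ, Real.sq_sqrt (by positivity)]; field_simp
  have hδlt : δ < S1 := by
    refine lt_of_pow_lt_pow_left₀ 2 hS1pos.le ?_
    nlinarith
  set v := (S1 - δ) / (1 + a) with hv
  have hv0 : 0 < v := div_pos (by linarith) (by linarith)
  set w := (S1 + a * δ) / (1 + a) / v with hwdef
  have hvw : v * w = (S1 + a * δ) / (1 + a) := by rw [hwdef]; field_simp
  have hw : 1 ≤ w := by
    rw [hwdef, le_div_iff₀ hv0, one_mul, hv]
    gcongr
    nlinarith
  have hs1 : S1 = v * (a + w) := by
    rw [mul_add, hvw, hv]; field_simp; ring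
  have hs2 : S2 = v ^ 2 * (a + w ^ 2) := by
    rw [mul_add, ← mul_pow, hvw, hv]; field_simp
    linear_combination (-(1 + a)) * hδ2
  have ht : ∀ i, 0 < y i / v := fun i => div_pos (hy i) hv0
  have h1 : ∑ i, y i / v = a + w := by
    rw [← Finset.sum_div, ← hS1, hs1]; field_simp
  have h2 : ∑ i, (y i / v) ^ 2 = a + w ^ 2 := by
    simp only [div_pow]
    rw [← Finset.sum_div, ← hS2, hs2]; field_simp
  have hmain := sum_sq_mul_log_le ht hw ha0.le hcard h1 h2
  have htwo := two_point_log_sobolev ha hl hl2 hw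
  have hsum : ∑ i, y i ^ 2 * Real.log (y i) =
      v ^ 2 * ∑ i, (y i / v) ^ 2 * Real.log (y i / v) + Real.log v * S2 := by
    rw [hS2, Finset.mul_sum, Finset.mul_sum, ← Finset.sum_add_distrib]
    refine Finset.sum_congr rfl fun i _ => ?_
    rw [Real.log_div (hy i).ne' hv0.ne']
    field_simp
    ring
  have haw : 0 < a + w ^ 2 := by positivity
  have hlogS : Real.log S2 = 2 * Real.log v + Real.log (a + w ^ 2) := by
    rw [hs2, Real.log_mul (by positivity) haw.ne', Real.log_pow]; norm_num
  rw [Real.log_div haw.ne' (by positivity)] at htwo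
  rw [hsum, hlogS]
  have hv2 : 0 < v ^ 2 := by positivity
  have e3 := mul_le_mul_of_nonneg_left hmain hv2.le
  have e4 := mul_le_mul_of_nonneg_left htwo hv2.le
  have e5 : (1 + a) * S2 - S1 ^ 2 = v ^ 2 * (a * (w - 1) ^ 2) := by rw [hs2, hs1]; ring
  rw [e5]
  rw [hs2]
  nlinarith

end Vectors

/-! ### Reduction to the maximally mixed state and to eigenvalues -/

variable {d : ℕ}

theorem hsDual_smul (L : Mat d →ₗ[ℂ] Mat d) (c : ℂ) (B : Mat d) :
    hsDual L (c • B) = c • hsDual L B := by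
  ext i j
  simp [hsDual]

theorem IsUnital.trace_map {L : Mat d →ₗ[ℂ] Mat d} (h : IsUnital L) (A : Mat d) :
    (L A).trace = 0 := by
  have := trace_hsDual L A 1
  rw [show hsDual L 1 = 0 from h] at this
  simpa [Matrix.trace_conjTranspose] using this.symm

theorem IsLiouvillian.map_one {L : Mat d →ₗ[ℂ] Mat d} (h : IsLiouvillian L) : L 1 = 0 := by
  obtain ⟨H, k, V, -, hV⟩ := h
  rw [hV]
  have : ∀ i, (V i)ᴴ * 1 * V i -
      (1 / 2 : ℂ) • ((V i)ᴴ * V i * 1 + 1 * ((V i)ᴴ * V i)) = 0 := by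
    intro i
    rw [mul_one, mul_one, one_mul, ← two_smul ℂ, smul_smul]
    norm_num
  simp only [this]
  simp

theorem stationaryState_eq {L : Mat d →ₗ[ℂ] Mat d} (hd : 0 < d) (hprim : IsPrimitive L)
    (hunital : IsUnital L) {σ : Mat d} (hσ : IsStationaryState L σ) :
    σ = algebraMap ℝ (Mat d) (d : ℝ)⁻¹ := by
  obtain ⟨σ₀, -, -, huniq⟩ := hprim
  have hd0 : (d : ℂ) ≠ 0 := by exact_mod_cast hd.ne'
  have key : IsStationaryState L (algebraMap ℝ (Mat d) (d : ℝ)⁻¹) := by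
    have e : algebraMap ℝ (Mat d) (d : ℝ)⁻¹ = ((d : ℂ)⁻¹) • (1 : Mat d) := by
      ext i j
      simp [Matrix.algebraMap_matrix_apply, Matrix.one_apply]
    rw [e]
    refine ⟨⟨?_, ?_⟩, ?_⟩
    · refine Matrix.PosSemidef.one.smul ?_
      rw [← Complex.ofReal_natCast, ← Complex.ofReal_inv]
      exact_mod_cast (by positivity : (0 : ℝ) ≤ (d : ℝ)⁻¹)
    · simp [hd0]
    · rw [hsDual_smul, show hsDual L 1 = 0 from hunital, smul_zero]
  rw [huniq σ hσ, huniq _ key]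

section Scalar

variable {c : ℝ}

theorem gammaPow_algebraMap (hc : 0 < c) (s : ℝ) (f : Mat d) :
    gammaPow (algebraMap ℝ (Mat d) c) s f = c ^ s • f := by
  rw [gammaPow, cfc_algebraMap, ← Algebra.smul_def, ← Algebra.commutes, ← Algebra.smul_def,
    smul_smul, ← Real.rpow_add hc, add_halves]

theorem variance_algebraMap (hc : 0 < c) (g : Mat d) :
    variance (algebraMap ℝ (Mat d) c) g = c * (g * g).trace.re - (c * g.trace.re) ^ 2 := by
  simp [variance, gammaPow_algebraMap hc, Matrix.trace_smul]

theorem dirichlet2_algebraMap (hc : 0 < c) (L : Mat d →ₗ[ℂ] Mat d) (g : Mat d) :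
    dirichlet2 L (algebraMap ℝ (Mat d) c) g = c * -(g * L g).trace.re := by
  simp [dirichlet2, wInner, gammaPow_algebraMap hc, Matrix.trace_smul]

theorem trace_cfc {X : Mat d} (hX : X.IsHermitian) (φ : ℝ → ℝ) :
    (cfc φ X).trace.re = ∑ i, φ (hX.eigenvalues i) := by
  rw [hX.cfc_eq, Matrix.IsHermitian.cfc, Unitary.conjStarAlgAut_apply, Matrix.trace_mul_cycle]
  simp [Matrix.trace]

theorem re_trace_sq {X : Mat d} (hX : X.IsHermitian) :
    (X * X).trace.re = ∑ i, hX.eigenvalues i ^ 2 := by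
  rw [← trace_cfc hX (fun x => x ^ 2), cfc_pow_id X 2 hX.isSelfAdjoint, sq]

theorem re_trace {X : Mat d} (hX : X.IsHermitian) :
    X.trace.re = ∑ i, hX.eigenvalues i := by
  simp [hX.trace_eq_sum_eigenvalues]

theorem re_trace_sq_mul_log {X : Mat d} (hX : X.IsHermitian) :
    (X ^ 2 * cfc Real.log X).trace.re =
      ∑ i, hX.eigenvalues i ^ 2 * Real.log (hX.eigenvalues i) := by
  have hcont : ∀ φ : ℝ → ℝ, ContinuousOn φ (spectrum ℝ X) := fun φ =>
    (Matrix.finite_real_spectrum (A := X)).continuousOn φ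
  rw [← trace_cfc hX (fun x => x ^ 2 * Real.log x), cfc_mul _ _ X (hcont _) (hcont _),
    cfc_pow_id X 2 hX.isSelfAdjoint]

/-- The `y i` are the eigenvalues of `X = √c f`, not of `f`; this absorbs the weight, so that `tr
X²` is `∑ y²`. -/
theorem exists_eigenvalues (hc : 0 < c) {f : Mat d} (hf : f.PosDef) :
    ∃ y : Fin d → ℝ, (∀ i, 0 < y i) ∧
      ent2 (algebraMap ℝ (Mat d) c) f = ∑ i, y i ^ 2 * Real.log (y i) -
        1 / 2 * Real.log c * ∑ i, y i ^ 2 - 1 / 2 * (∑ i, y i ^ 2) * Real.log (∑ i, y i ^ 2) ∧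
      variance (algebraMap ℝ (Mat d) c) f = ∑ i, y i ^ 2 - c * (∑ i, y i) ^ 2 := by
  set r := c ^ (1 / 2 : ℝ) with hr
  have hr0 : 0 < r := Real.rpow_pos_of_pos hc _
  have hrr : r * r = c := by
    rw [hr, ← Real.rpow_add hc]; norm_num
  have hX : (r • f).PosDef := hf.smul hr0
  have hXh := hX.isHermitian
  have hsq := re_trace_sq hXh
  refine ⟨hXh.eigenvalues, hX.eigenvalues_pos, ?_, ?_⟩
  · have hn : norm2 (algebraMap ℝ (Mat d) c) f ^ 2 = ∑ i, hXh.eigenvalues i ^ 2 := by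
      rw [norm2, gammaPow_algebraMap hc, ← hr, hXh.eq, hsq,
        Real.sq_sqrt (Finset.sum_nonneg fun i _ => sq_nonneg _)]
    rw [ent2, hn, gammaPow_algebraMap hc, ← hr, re_trace_sq_mul_log hXh, cfc_algebraMap,
      ← Algebra.commutes, ← Algebra.smul_def, Matrix.trace_smul, Complex.real_smul,
      Complex.re_ofReal_mul, sq (r • f), hsq]
    ring
  · rw [variance_algebraMap hc, ← hsq, ← re_trace hXh]
    simp only [Matrix.smul_mul, Matrix.mul_smul, Matrix.trace_smul, Complex.real_smul,
      Complex.re_ofReal_mul]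
    rw [← hrr]; ring

end Scalar

/-! ### Entropy against variance -/

/-- Here `l = log (d - 1) / (d - 2)`, with limit value `1` at `d = 2`. The equation for `l` is empty
at `d = 2`, so the inequality `2 ≤ l * d` carries the content there, and both cases can be treated
alike. -/
theorem exists_lsFactor_eq (hd : 2 ≤ d) :
    ∃ l : ℝ, l * ((d : ℝ) - 1 - 1) = Real.log ((d : ℝ) - 1) ∧ 2 ≤ l * d ∧
      lsFactor d = 2 / (l * d) := by
  rcases hd.eq_or_lt with rfl | hd
  · exact ⟨1, by norm_num, by norm_num, by norm_num [lsFactor]⟩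
  · have hd' : (3 : ℝ) ≤ d := by exact_mod_cast hd
    have h2 : 0 < (d : ℝ) - 1 - 1 := by linarith
    have hlog := Real.log_pos (show 1 < (d : ℝ) - 1 by linarith)
    have := two_mul_sub_one_le_mul_log (show 1 ≤ (d : ℝ) - 1 by linarith)
    refine ⟨Real.log ((d : ℝ) - 1) / ((d : ℝ) - 1 - 1), by field_simp, ?_, ?_⟩
    · rw [div_mul_eq_mul_div, le_div_iff₀ h2]; linarith
    · rw [lsFactor, if_neg hd.ne']
      field_simp
      ring

theorem lsFactor_mul_ent2_le (hd : 2 ≤ d) {f : Mat d} (hf : f.PosDef) :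
    lsFactor d * ent2 (algebraMap ℝ (Mat d) (d : ℝ)⁻¹) f ≤
      variance (algebraMap ℝ (Mat d) (d : ℝ)⁻¹) f := by
  have hd' : (2 : ℝ) ≤ d := by exact_mod_cast hd
  have hd0 : (0 : ℝ) < d := by linarith
  obtain ⟨y, hy, hent, hvar⟩ := exists_eigenvalues (inv_pos.2 hd0) hf
  obtain ⟨l, hl, hl2, hfac⟩ := exists_lsFactor_eq hd
  have key := complete_graph_log_sobolev (a := (d : ℝ) - 1) (l := l) (by linarith) hl
    (by rw [add_sub_cancel]; exact hl2) (by simp) hy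
  rw [add_sub_cancel] at key
  rw [hent, hvar, hfac, Real.log_inv, div_mul_eq_mul_div, div_le_iff₀ (by linarith)]
  have : (∑ i, y i ^ 2 - (d : ℝ)⁻¹ * (∑ i, y i) ^ 2) * (l * d) =
      l * (d * ∑ i, y i ^ 2 - (∑ i, y i) ^ 2) := by field_simp
  rw [this]
  linarith

/-- Twice the entropy is `∑ u log (u / m)` with `u = y²` and `m` the mean of the `u`. By Gibbs'
inequality this is positive unless all eigenvalues agree, which would make the variance zero. -/
theorem ent2_pos (hd : 0 < d) {f : Mat d} (hf : f.PosDef)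
    (hvar : variance (algebraMap ℝ (Mat d) (d : ℝ)⁻¹) f ≠ 0) :
    0 < ent2 (algebraMap ℝ (Mat d) (d : ℝ)⁻¹) f := by
  have hd0 : (0 : ℝ) < d := by exact_mod_cast hd
  obtain ⟨y, hy, hent, hv⟩ := exists_eigenvalues (inv_pos.2 hd0) hf
  have : Nonempty (Fin d) := ⟨⟨0, hd⟩⟩
  set S := ∑ i, y i ^ 2 with hS
  have hS0 : 0 < S := Finset.sum_pos (fun i _ => pow_pos (hy i) 2) Finset.univ_nonempty
  have hm : 0 < S / d := by positivity
  have hne : ∃ i, y i ^ 2 ≠ S / d := by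
    by_contra! hall
    have hall' : ∀ i, y i = Real.sqrt (S / d) := fun i => by
      rw [← hall i, Real.sqrt_sq (hy i).le]
    refine hvar ?_
    rw [hv]
    simp only [hall', Finset.sum_const, Finset.card_univ, Fintype.card_fin, nsmul_eq_mul, mul_pow,
      Real.sq_sqrt hm.le]
    field_simp
    ring
  have term : ∀ u : ℝ, 0 < u → u - S / d ≤ u * Real.log u - u * Real.log (S / d) := by
    intro u hu
    have := Real.one_sub_inv_le_log_of_pos (div_pos hu hm)
    rw [Real.log_div hu.ne' hm.ne', inv_div] at this
    have := mul_le_mul_of_nonneg_left this hu.le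
    rw [mul_sub, mul_div_cancel₀ _ hu.ne'] at this
    linarith
  have term' : ∀ u : ℝ, 0 < u → u ≠ S / d →
      u - S / d < u * Real.log u - u * Real.log (S / d) := by
    intro u hu hne
    have := Real.log_lt_sub_one_of_pos (div_pos hm hu) (by rw [Ne, div_eq_one_iff_eq hu.ne']; exact hne.symm)
    rw [Real.log_div hm.ne' hu.ne'] at this
    have := mul_lt_mul_of_pos_left this hu
    rw [mul_sub, mul_sub, mul_div_cancel₀ _ hu.ne'] at this
    linarith
  have hsum : ∑ i, (y i ^ 2 - S / d) <
      ∑ i, (y i ^ 2 * Real.log (y i ^ 2) - y i ^ 2 * Real.log (S / d)) := by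
    obtain ⟨i, hi⟩ := hne
    exact Finset.sum_lt_sum (fun i _ => term _ (pow_pos (hy i) 2))
      ⟨i, Finset.mem_univ i, term' _ (pow_pos (hy i) 2) hi⟩
  have e0 : ∑ i, (y i ^ 2 - S / d) = 0 := by
    rw [Finset.sum_sub_distrib, ← hS]
    simp
    field_simp
    ring
  have e1 : ∑ i, (y i ^ 2 * Real.log (y i ^ 2) - y i ^ 2 * Real.log (S / d)) =
      2 * (∑ i, y i ^ 2 * Real.log (y i)) - S * (Real.log S - Real.log d) := by
    rw [Finset.sum_sub_distrib, ← Finset.sum_mul, ← hS, Real.log_div hS0.ne' hd0.ne',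
      Finset.mul_sum]
    congr 1
    refine Finset.sum_congr rfl fun i _ => ?_
    rw [Real.log_pow]; push_cast; ring
  rw [e0, e1] at hsum
  rw [hent, Real.log_inv]
  linarith

/-! ### The Dirichlet form and attainment of the gap -/

/-- The form equals `½ ∑ tr |[V i, g]|²`: the Hamiltonian part vanishes by cyclicity of the trace,
and unitality, as `tr L(g²) = 0`, balances the two terms in `g²`. No detailed balance is needed. -/
theorem neg_re_trace_mul_map_nonneg {L : Mat d →ₗ[ℂ] Mat d} (hL : IsLiouvillian L)
    (hunital : IsUnital L) {g : Mat d} (hg : g.IsHermitian) : 0 ≤ -(g * L g).trace.re := by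
  obtain ⟨H, k, V, -, hV⟩ := hL
  have htr := hunital.trace_map (g * g)
  have hW : ∀ i, 0 ≤ ((V i * g - g * V i)ᴴ * (V i * g - g * V i)).trace.re := fun i =>
    (Complex.nonneg_iff.1 (Matrix.posSemidef_conjTranspose_mul_self _).trace_nonneg).1
  have hWe : ∀ i, ((V i * g - g * V i)ᴴ * (V i * g - g * V i)).trace =
      ((V i)ᴴ * V i * (g * g)).trace - 2 * (g * ((V i)ᴴ * g * V i)).trace +
        ((V i)ᴴ * (g * g) * V i).trace := by
    intro i
    have e : (V i * g - g * V i)ᴴ * (V i * g - g * V i) =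
        g * (((V i)ᴴ * V i) * g) - g * ((V i)ᴴ * g * V i) - ((V i)ᴴ * g * V i) * g +
          (V i)ᴴ * (g * g) * V i := by
      rw [Matrix.conjTranspose_sub, Matrix.conjTranspose_mul, Matrix.conjTranspose_mul, hg.eq]
      noncomm_ring
    rw [e, Matrix.trace_add, Matrix.trace_sub, Matrix.trace_sub,
      Matrix.trace_mul_comm ((V i)ᴴ * g * V i) g, Matrix.trace_mul_comm g (((V i)ᴴ * V i) * g),
      mul_assoc ((V i)ᴴ * V i) g g]
    ring
  have h1 : ∑ i, (((V i)ᴴ * (g * g) * V i).trace - ((V i)ᴴ * V i * (g * g)).trace) = 0 := by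
    rw [hV, Matrix.trace_add, Matrix.trace_smul, Matrix.trace_sub, Matrix.trace_mul_comm H,
      sub_self, smul_zero, zero_add, Matrix.trace_sum] at htr
    rw [← htr]
    refine Finset.sum_congr rfl fun i _ => ?_
    rw [Matrix.trace_sub, Matrix.trace_smul, Matrix.trace_add,
      Matrix.trace_mul_comm (g * g) ((V i)ᴴ * V i), smul_eq_mul]
    ring
  have h2 : (g * L g).trace =
      ∑ i, ((g * ((V i)ᴴ * g * V i)).trace - ((V i)ᴴ * V i * (g * g)).trace) := by
    rw [hV, mul_add, Matrix.trace_add, Matrix.mul_smul, Matrix.trace_smul, mul_sub,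
      Matrix.trace_sub, ← mul_assoc g H g, Matrix.trace_mul_comm (g * H) g, sub_self, smul_zero,
      zero_add, Finset.mul_sum, Matrix.trace_sum]
    refine Finset.sum_congr rfl fun i _ => ?_
    rw [mul_sub, Matrix.trace_sub, Matrix.mul_smul, Matrix.trace_smul, mul_add, Matrix.trace_add,
      Matrix.trace_mul_comm g ((V i)ᴴ * V i * g), mul_assoc ((V i)ᴴ * V i) g g, ← mul_assoc g g,
      Matrix.trace_mul_comm (g * g) ((V i)ᴴ * V i), smul_eq_mul]
    ring
  have h3 : -(g * L g).trace = (1 / 2 : ℝ) *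
      ∑ i, ((V i * g - g * V i)ᴴ * (V i * g - g * V i)).trace := by
    rw [h2, ← sub_eq_zero]
    simp only [hWe]
    push_cast
    rw [Finset.mul_sum, ← Finset.sum_neg_distrib, ← Finset.sum_sub_distrib]
    rw [← mul_zero (-1 / 2 : ℂ), ← h1, Finset.mul_sum]
    refine Finset.sum_congr rfl fun i _ => ?_
    ring
  rw [← Complex.neg_re, h3, Complex.re_ofReal_mul, Complex.re_sum]
  exact mul_nonneg (by norm_num) (Finset.sum_nonneg fun i _ => hW i)

theorem re_trace_mul_self {g : Mat d} (hg : g.IsHermitian) :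
    (g * g).trace.re = ∑ i, ∑ j, ‖g i j‖ ^ 2 := by
  have : (g * g).trace = ∑ i, ∑ j, ((‖g i j‖ ^ 2 : ℝ) : ℂ) := by
    simp only [Matrix.trace, Matrix.diag_apply, Matrix.mul_apply]
    refine Finset.sum_congr rfl fun i _ => Finset.sum_congr rfl fun j _ => ?_
    rw [← hg.apply j i, Complex.ofReal_pow, ← Complex.mul_conj']
    rfl
  rw [this]
  simp only [Complex.re_sum, Complex.ofReal_re]

theorem isCompact_sphere (d : ℕ) :
    IsCompact {g : Mat d | g.IsHermitian ∧ g.trace = 0 ∧ (g * g).trace.re = 1} := by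
  have hK : IsCompact (Set.univ.pi fun _ : Fin d => Set.univ.pi fun _ : Fin d =>
      Metric.closedBall (0 : ℂ) 1) :=
    isCompact_univ_pi fun _ => isCompact_univ_pi fun _ => isCompact_closedBall _ _
  refine hK.of_isClosed_subset ?_ ?_
  · refine IsClosed.inter ?_ (IsClosed.inter ?_ ?_)
    · exact isClosed_eq (continuous_id.matrix_conjTranspose) continuous_id
    · exact isClosed_eq (continuous_id.matrix_trace) continuous_const
    · exact isClosed_eq (Complex.continuous_re.comp
        (continuous_id.matrix_mul continuous_id).matrix_trace) continuous_const
  · rintro g ⟨hg, -, h1⟩ i - j -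
    rw [re_trace_mul_self hg] at h1
    rw [mem_closedBall_zero_iff, ← sq_le_one_iff₀ (norm_nonneg _), ← h1]
    refine (Finset.single_le_sum (f := fun j => ‖g i j‖ ^ 2) (fun j _ => sq_nonneg _)
      (Finset.mem_univ j)).trans ?_
    exact Finset.single_le_sum (f := fun i => ∑ j, ‖g i j‖ ^ 2)
      (fun i _ => Finset.sum_nonneg fun j _ => sq_nonneg _) (Finset.mem_univ i)

/-- A positive definite matrix which is not a multiple of the identity. -/
def bump (d : ℕ) : Mat d := Matrix.diagonal fun i => if (i : ℕ) = 0 then 2 else 1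

theorem bump_posDef (d : ℕ) : (bump d).PosDef := by
  refine Matrix.PosDef.diagonal fun i => ?_
  split_ifs <;> norm_num

theorem variance_bump_ne_zero (hd : 2 ≤ d) :
    variance (algebraMap ℝ (Mat d) (d : ℝ)⁻¹) (bump d) ≠ 0 := by
  obtain ⟨n, rfl⟩ : ∃ n, d = n + 1 := ⟨d - 1, by omega⟩
  have hn : (1 : ℝ) ≤ n := by exact_mod_cast (by omega : 1 ≤ n)
  rw [variance_algebraMap (by positivity)]
  have h1 : (bump (n + 1)).trace.re = 2 + n := by
    simp [bump, Matrix.trace_diagonal, Fin.sum_univ_succ]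
  have h2 : (bump (n + 1) * bump (n + 1)).trace.re = 4 + n := by
    rw [bump, Matrix.diagonal_mul_diagonal, Matrix.trace_diagonal, Fin.sum_univ_succ]
    norm_num
  rw [h1, h2]
  push_cast
  intro h
  field_simp at h
  nlinarith

section Gap

variable {L : Mat d →ₗ[ℂ] Mat d} {g : Mat d}

/-- Subtracting the mean of a Hermitian matrix changes neither the Dirichlet form nor the
variance. -/
theorem exists_centered (hd : 0 < d) (hL1 : L 1 = 0) (hunital : IsUnital L) (hg : g.IsHermitian) :
    ∃ h : Mat d, h.IsHermitian ∧ h.trace = 0 ∧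
      (h * L h).trace.re = (g * L g).trace.re ∧
      variance (algebraMap ℝ (Mat d) (d : ℝ)⁻¹) g = (d : ℝ)⁻¹ * (h * h).trace.re := by
  have hd0 : (0 : ℝ) < d := by exact_mod_cast hd
  have hd0' : (d : ℂ) ≠ 0 := by exact_mod_cast hd.ne'
  set m : ℝ := g.trace.re / d with hm
  have htr : g.trace = ((m * d : ℝ) : ℂ) := by
    rw [hm, div_mul_cancel₀ _ hd0.ne']
    refine Complex.ext rfl ?_
    have := congrArg Complex.im (Matrix.trace_conjTranspose g)
    rw [hg.eq] at this
    simp at this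
    rw [Complex.ofReal_im]
    linarith
  refine ⟨g - (m : ℂ) • 1, ?_, ?_, ?_, ?_⟩
  · refine hg.sub ?_
    rw [Matrix.IsHermitian, Matrix.conjTranspose_smul]
    simp
  · rw [Matrix.trace_sub, Matrix.trace_smul, htr]
    simp
  -- One cross term dies by `L 1 = 0`, the other by `tr (L g) = 0`.
  · rw [map_sub, map_smul, hL1, smul_zero, sub_zero, sub_mul, Matrix.trace_sub, smul_mul_assoc,
      one_mul, Matrix.trace_smul, hunital.trace_map, smul_zero, sub_zero]
  · have e : ((g - (m : ℂ) • 1) * (g - (m : ℂ) • 1)).trace =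
        (g * g).trace - 2 * m * g.trace + m ^ 2 * d := by
      have : (g - (m : ℂ) • 1) * (g - (m : ℂ) • 1) =
          g * g - (2 * m : ℂ) • g + (m ^ 2 : ℂ) • (1 : Mat d) := by
        simp only [sub_mul, mul_sub, smul_mul_assoc, mul_smul_comm, one_mul, mul_one]
        module
      rw [this]
      simp
    have e' : ((g - (m : ℂ) • 1) * (g - (m : ℂ) • 1)).trace.re =
        (g * g).trace.re - m ^ 2 * d := by
      rw [e, htr]
      have : (g * g).trace - 2 * (m : ℂ) * ((m * d : ℝ) : ℂ) + m ^ 2 * d =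
          (g * g).trace - ((m ^ 2 * d : ℝ) : ℂ) := by
        push_cast; ring
      rw [this, Complex.sub_re, Complex.ofReal_re]
    rw [e', variance_algebraMap (inv_pos.2 hd0), htr, Complex.ofReal_re]
    field_simp

/-- The quotient is invariant under shifts by real multiples of `1` and under scaling, so its values
are those on the compact Hilbert–Schmidt unit sphere of traceless Hermitian matrices, where it is
continuous. -/
theorem exists_isLeast_gapQuotients (hd : 2 ≤ d) (hL : IsLiouvillian L) (hunital : IsUnital L) :
    ∃ r, 0 ≤ r ∧ IsLeast (gapQuotients L (algebraMap ℝ (Mat d) (d : ℝ)⁻¹)) r := by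
  have hd0 : (0 : ℝ) < d := by exact_mod_cast (by omega : 0 < d)
  have hd1 := inv_pos.2 hd0
  have normalize : ∀ g : Mat d, g.IsHermitian →
      variance (algebraMap ℝ (Mat d) (d : ℝ)⁻¹) g ≠ 0 →
      ∃ h ∈ {g : Mat d | g.IsHermitian ∧ g.trace = 0 ∧ (g * g).trace.re = 1},
        -(h * L h).trace.re = dirichlet2 L (algebraMap ℝ (Mat d) (d : ℝ)⁻¹) g /
          variance (algebraMap ℝ (Mat d) (d : ℝ)⁻¹) g := by
    intro g hg hv
    obtain ⟨h, hh, h0, hE, hV⟩ := exists_centered (by omega) hL.map_one hunital hg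
    rw [hV] at hv
    set T := (h * h).trace.re with hT
    have hT0 : 0 < T := lt_of_le_of_ne
      (by rw [hT, re_trace_sq hh]; exact Finset.sum_nonneg fun i _ => sq_nonneg _)
      (right_ne_zero_of_mul hv).symm
    set s := (Real.sqrt T)⁻¹ with hs
    have hss : s * s = T⁻¹ := by rw [hs, ← mul_inv, Real.mul_self_sqrt hT0.le]
    have hsc : ((s : ℂ) * s) = ((T⁻¹ : ℝ) : ℂ) := by rw [← hss]; push_cast; rfl
    refine ⟨(s : ℂ) • h, ⟨?_, ?_, ?_⟩, ?_⟩
    · rw [Matrix.IsHermitian, Matrix.conjTranspose_smul, hh.eq]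
      simp
    · rw [Matrix.trace_smul, h0, smul_zero]
    · rw [smul_mul_assoc, mul_smul_comm, smul_smul, Matrix.trace_smul, hsc, smul_eq_mul,
        Complex.re_ofReal_mul, ← hT, inv_mul_cancel₀ hT0.ne']
    · rw [map_smul, smul_mul_assoc, mul_smul_comm, smul_smul, Matrix.trace_smul, hsc, smul_eq_mul,
        Complex.re_ofReal_mul, hE, dirichlet2_algebraMap hd1, hV]
      field_simp
  obtain ⟨h₀, hh₀, -⟩ := normalize _ (bump_posDef d).isHermitian (variance_bump_ne_zero hd)
  have hcont : Continuous fun g : Mat d => -(g * L g).trace.re :=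
    (Complex.continuous_re.comp (continuous_id.matrix_mul
      (LinearMap.continuous_of_finiteDimensional L)).matrix_trace).neg
  obtain ⟨m, hm, hmin⟩ := (isCompact_sphere d).exists_isMinOn ⟨h₀, hh₀⟩ hcont.continuousOn
  refine ⟨-(m * L m).trace.re, neg_re_trace_mul_map_nonneg hL hunital hm.1, ⟨m, hm.1, ?_, ?_⟩, ?_⟩
  · rw [variance_algebraMap hd1, hm.2.1, hm.2.2]
    simp [hd0.ne']
  · rw [variance_algebraMap hd1, dirichlet2_algebraMap hd1, hm.2.1, hm.2.2]
    simp
    field_simp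
  · rintro _ ⟨g, hg, hv, rfl⟩
    obtain ⟨h, hh, e⟩ := normalize g hg hv
    rw [← e]
    exact hmin hh

end Gap

end QLogSobolev

/-! ### Assembly -/

open QLogSobolev in
theorem mainTheorem10 (d : ℕ) (hd : 2 ≤ d)
    (L : QLogSobolev.Mat d →ₗ[ℂ] QLogSobolev.Mat d)
    (hL : QLogSobolev.IsLiouvillian L)
    (hprim : QLogSobolev.IsPrimitive L)
    (hunital : QLogSobolev.IsUnital L)
    (σ : QLogSobolev.Mat d) (hσ : QLogSobolev.IsStationaryState L σ) :
    IsLeast (QLogSobolev.gapQuotients L σ) (QLogSobolev.spectralGap L σ) ∧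
    IsGreatest (QLogSobolev.lsi2Constants L σ) (QLogSobolev.logSobolev2 L σ) ∧
    QLogSobolev.lsFactor d * QLogSobolev.spectralGap L σ ≤ QLogSobolev.logSobolev2 L σ := by
  obtain rfl := stationaryState_eq (by omega) hprim hunital hσ
  have hd0 : (0 : ℝ) < d := by exact_mod_cast (by omega : 0 < d)
  set σ := algebraMap ℝ (Mat d) (d : ℝ)⁻¹ with hσdef
  obtain ⟨r, hr0, hr⟩ := exists_isLeast_gapQuotients hd hL hunital
  have hgap : spectralGap L σ = r := hr.csInf_eq
  have hpoincare : ∀ f : Mat d, f.PosDef → r * variance σ f ≤ dirichlet2 L σ f := by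
    intro f hf
    have hv0 : 0 ≤ variance σ f := by
      obtain ⟨h, hh, -, -, hV⟩ :=
        exists_centered (by omega) hL.map_one hunital hf.isHermitian
      rw [hσdef, hV, re_trace_sq hh]
      exact mul_nonneg (inv_pos.2 hd0).le (Finset.sum_nonneg fun i _ => sq_nonneg _)
    -- At variance zero no Rayleigh quotient is available, and positivity of the Dirichlet form
    -- takes over.
    rcases hv0.eq_or_lt with hv | hv
    · rw [← hv, mul_zero, hσdef, dirichlet2_algebraMap (inv_pos.2 hd0)]
      exact mul_nonneg (inv_pos.2 hd0).le
        (neg_re_trace_mul_map_nonneg hL hunital hf.isHermitian)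
    · rw [← le_div_iff₀ hv]
      exact hr.2 ⟨f, hf.isHermitian, hv.ne', rfl⟩
  have hmem : lsFactor d * r ∈ lsi2Constants L σ := by
    intro f hf
    calc lsFactor d * r * ent2 σ f = r * (lsFactor d * ent2 σ f) := by ring
      _ ≤ r * variance σ f := mul_le_mul_of_nonneg_left (lsFactor_mul_ent2_le hd hf) hr0
      _ ≤ _ := hpoincare f hf
  have hbdd : BddAbove (lsi2Constants L σ) := by
    have hpos := ent2_pos (by omega) (bump_posDef d) (variance_bump_ne_zero hd)
    refine ⟨dirichlet2 L σ (bump d) / ent2 σ (bump d), fun α hα => ?_⟩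
    rw [le_div_iff₀ hpos]
    exact hα _ (bump_posDef d)
  -- Each `f` imposes a closed condition on `α`, so the supremum is itself admissible.
  have hclosed : IsClosed (lsi2Constants L σ) := by
    have : lsi2Constants L σ = ⋂ (f : Mat d) (_ : f.PosDef),
        {α | α * ent2 σ f ≤ dirichlet2 L σ f} := by
      ext α
      simp [lsi2Constants]
    rw [this]
    exact isClosed_biInter fun f _ =>
      isClosed_le (continuous_id.mul continuous_const) continuous_const
  refine ⟨hgap ▸ hr, ⟨hclosed.csSup_mem ⟨_, hmem⟩ hbdd, fun α hα => le_csSup hbdd hα⟩, ?_⟩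
  rw [hgap]
  exact le_csSup hbdd hmem
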